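/- \textbf{Definitions.} A represented space $(X,\delta_X)$ is a set $X$ with a surjective partial map $\delta_X:\subseteq\mathbb N^{\mathbb N}\to X$; if $\delta_X(p)=x$, then $p$ is called a name of $x$. A partial function $F:\subseteq\mathbb N^{\mathbb N}\to\mathbb N^{\mathbb N}$ is computable if there is a computable function $\varphi:\mathbb N^*\to\mathbb N^*$ on finite words, monotone for the prefix order, such that for every $p\in\mathrm{dom}(F)$ the words $\varphi(p(0)\cdots p(n-1))$, $n\in\mathbb N$, are prefixes of $F(p)$ of unbounded length. For a partial multi-valued function $f:\subseteq X\rightrightarrows Y$ between represented spaces, with $\mathrm{dom}(f)=\{x: f(x)\neq\emptyset\}$, a realizer is a partial function $F:\subseteq\mathbb N^{\mathbb N}\to\mathbb N^{\mathbb N}$ with $\delta_Y(F(p))\in f(\delta_X(p))$ for all $p$ with $\delta_X(p)\in\mathrm{dom}(f)$. One writes $f\leq_{\mathrm W}g$ ($f$ is Weihrauch reducible to $g$) if there are computable $K,H:\subseteq\mathbb N^{\mathbb N}\to\mathbb N^{\mathbb N}$ such that $p\mapsto H\langle p,G(K(p))\rangle$ is a realizer of $f$ for every realizer $G$ of $g$,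 where $\langle p,q\rangle(2k)=p(k)$ and $\langle p,q\rangle(2k+1)=q(k)$. The jump $f'$ of $f$ is the same multi-valued function, with the representation $\delta_X$ of its source replaced by $\delta_X\circ\lim$, where $\lim:\subseteq\mathbb N^{\mathbb N}\to\mathbb N^{\mathbb N}$, $\langle p_0,p_1,p_2,\dots\rangle\mapsto\lim_{i\to\infty}p_i$ (limit in the product topology), $\langle p_0,p_1,\dots\rangle(\langle i,j\rangle)=p_i(j)$, and $\langle i,j\rangle=\frac12(i+j+1)(i+j)+j$. By $f^{(n)}$ we denote the $n$-fold jump, with $f^{(0)}=f$. Let $\mu_{2^{\mathbb N}}$ be the product on $2^{\mathbb N}$ of the uniform measures on $\{0,1\}$, and $\mu_{\mathbb N^{\mathbb N}}$ the product on $\mathbb N^{\mathbb N}$ of the geometric probability measures $\{k\}\mapsto 2^{-k-1}$ on $\mathbb N$. The spaces $2^{\mathbb N}$ and $\mathbb N^{\mathbb N}$ are represented by the identity (every point is its only name). \begin{itemize} \item $\mathsf{WKL}$ (Weak K\H{o}nig's Lemma) maps an infinite binary tree $T\subseteq\{0,1\}^*$, given by its characteristic function, to the set $[T]\subseteq 2^{\mathbb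 N}$ of its infinite paths. \item $\mathsf{WWKL}$ (Weak Weak K\H{o}nig's Lemma) maps a binary tree $T$ with $\mu_{2^{\mathbb N}}([T])>0$, given by its characteristic function, to $[T]$. \item $\mathsf{PC}_{\mathbb N^{\mathbb N}}$ (positive choice on Baire space) maps a closed set $A\subseteq\mathbb N^{\mathbb N}$ with $\mu_{\mathbb N^{\mathbb N}}(A)>0$ to the set of its points, where $A$ is given by negative information: a name of $A$ is a list of open balls, each empty or a cylinder $w\mathbb N^{\mathbb N}$ with $w\in\mathbb N^*$, whose union is $\mathbb N^{\mathbb N}\setminus A$. \end{itemize} \textbf{Corollary 14.8.} For every $n\in\mathbb N$, \[\mathsf{WKL}\not\leq_{\mathrm W}\mathsf{PC}_{\mathbb N^{\mathbb N}}^{(n)},\] and, in particular, $\mathsf{WKL}\not\leq_{\mathrm W}\mathsf{WWKL}^{(n)}$ for every $n\in\mathbb N$. -/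

import Mathlib

namespace Weih

open MeasureTheory Filter Topology

/-- Baire space `ℕ^ℕ`, with the product topology and its Borel σ-algebra. -/
abbrev Baire : Type := ℕ → ℕ

/-- Cantor space `2^ℕ`, with the product topology and its Borel σ-algebra. -/
abbrev Cantor : Type := ℕ → Bool

/-- The prefix of length `n` of an infinite sequence. -/
def pre {α : Type} (x : ℕ → α) (n : ℕ) : List α := (List.range n).map x

/-! ### Pairings -/

/-- The Cantor pair `⟨n, k⟩ = (n + k + 1)(n + k)/2 + k`. -/
def cantorPair (n k : ℕ) : ℕ := (n + k + 1) * (n + k) / 2 + k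

/-- The pairing `⟨p, q⟩` of two sequences: `p` on even and `q` on odd positions. -/
def seqPair (p q : Baire) : Baire := fun n => if n % 2 = 0 then p (n / 2) else q (n / 2)

theorem cantorPair_lt (n k : ℕ) :
    (n + k) * (n + k + 1) ≤ 2 * cantorPair n k ∧
      2 * cantorPair n k < (n + k + 1) * (n + k + 2) := by
  have h : 2 ∣ (n + k + 1) * (n + k) := by
    rw [mul_comm]; exact (Nat.even_mul_succ_self (n + k)).two_dvd
  obtain ⟨c, hc⟩ := h
  have hd : (n + k + 1) * (n + k) / 2 = c := by omega
  simp only [cantorPair, hd]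
  constructor <;> nlinarith

theorem cantorPair_injective {n k n' k' : ℕ} (h : cantorPair n k = cantorPair n' k') :
    n = n' ∧ k = k' := by
  have h1 := cantorPair_lt n k
  have h2 := cantorPair_lt n' k'
  have hs : n + k = n' + k' := by
    rcases lt_trichotomy (n + k) (n' + k') with hl | hl | hl
    · nlinarith
    · exact hl
    · nlinarith
  have hk : k = k' := by
    simp only [cantorPair, hs] at h
    omega
  omega

/-! ### Computable partial functions on Baire space -/

/-- A partial function `F :⊆ ℕ^ℕ → ℕ^ℕ` is computable if there is a computable function `φ` on
finite words, monotone for the prefix order, such that for all `p ∈ dom F` the words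
`φ (p(0) ⋯ p(n-1))`, `n ∈ ℕ`, converge to the infinite sequence `F p`. -/
def ComputableFun (F : Baire →. Baire) : Prop :=
  ∃ φ : List ℕ → List ℕ, Computable φ ∧ (∀ u v : List ℕ, u <+: v → φ u <+: φ v) ∧
    ∀ p q : Baire, q ∈ F p → ∀ m : ℕ, ∃ n : ℕ, pre q m <+: φ (pre p n)

/-! ### Represented spaces -/

/-- A represented space: a set with a surjective partial map from Baire space. -/
structure RepSpace where
  /-- the underlying set -/
  carrier : Type
  /-- the representation -/
  rep : Baire →. carrier
  /-- every point has a name -/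
  surj : ∀ x : carrier, ∃ p : Baire, x ∈ rep p

/-- The representation in which every point `x` has exactly one name `c x`, i.e. the
partial inverse of an injective map `c`. -/
noncomputable def RepSpace.ofInjective {X : Type} (c : X → Baire) (hc : Function.Injective c) :
    RepSpace where
  carrier := X
  rep := fun p => ⟨∃ x, c x = p, fun h => h.choose⟩
  surj := fun x => ⟨c x, ⟨x, rfl⟩, hc (Exists.choose_spec (⟨x, rfl⟩ : ∃ y, c y = c x))⟩

/-- The limit map `lim ⟨p₀, p₁, p₂, …⟩ = lim_{i → ∞} p_i` on Baire space, where
`⟨p₀, p₁, p₂, …⟩ ⟨i, j⟩ = p_i j`. -/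
noncomputable def limMap : Baire →. Baire := fun p =>
  ⟨∃ q : Baire, Tendsto (fun i j => p (cantorPair i j)) atTop (𝓝 q), fun h => h.choose⟩

theorem mem_limMap {p q : Baire} :
    q ∈ limMap p ↔ Tendsto (fun i j => p (cantorPair i j)) atTop (𝓝 q) := by
  constructor
  · rintro ⟨h, rfl⟩
    exact h.choose_spec
  · intro h
    exact ⟨⟨q, h⟩, tendsto_nhds_unique (Exists.choose_spec (⟨q, h⟩ : ∃ q : Baire,
      Tendsto (fun i j => p (cantorPair i j)) atTop (𝓝 q))) h⟩

theorem limMap_surj (q : Baire) : ∃ p, q ∈ limMap p := by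
  classical
  refine ⟨fun m => if h : ∃ a : ℕ × ℕ, cantorPair a.1 a.2 = m then q h.choose.2 else 0, ?_⟩
  rw [mem_limMap]
  refine Tendsto.congr (f₁ := fun _ => q) (fun i => ?_) tendsto_const_nhds
  funext j
  have h : ∃ a : ℕ × ℕ, cantorPair a.1 a.2 = cantorPair i j := ⟨(i, j), rfl⟩
  rw [dif_pos h, (cantorPair_injective h.choose_spec).2]

/-- The jump `(X, δ ∘ lim)` of a represented space `(X, δ)`. -/
noncomputable def RepSpace.jump (X : RepSpace) : RepSpace where
  carrier := X.carrier
  rep := X.rep.comp limMap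
  surj := fun x => by
    obtain ⟨q, hq⟩ := X.surj x
    obtain ⟨p, hp⟩ := limMap_surj q
    exact ⟨p, by rw [PFun.comp_apply]; exact Part.mem_bind hp hq⟩

/-! ### Multi-valued functions, realizers, Weihrauch reducibility -/

/-- A partial multi-valued function `f :⊆ X ⇉ Y` between represented spaces. Its domain is
`{x | f x ≠ ∅}`. -/
structure Problem where
  /-- the source space -/
  X : RepSpace
  /-- the target space -/
  Y : RepSpace
  /-- the set of possible values at a point -/
  val : X.carrier → Set Y.carrier

/-- The domain of a partial multi-valued function. -/
def Problem.dom (f : Problem) : Set f.X.carrier := {x | (f.val x).Nonempty}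

/-- `F ⊢ f`: for every name `p` of a point `x ∈ dom f`, the value `F p` exists and is a
name of a point of `f x`. -/
def Realizes (F : Baire →. Baire) (f : Problem) : Prop :=
  ∀ (p : Baire) (x : f.X.carrier), x ∈ f.X.rep p → x ∈ f.dom →
    ∃ q ∈ F p, ∃ y ∈ f.Y.rep q, y ∈ f.val x

/-- Weihrauch reducibility: there are computable `K, H :⊆ ℕ^ℕ → ℕ^ℕ` such that
`p ↦ H ⟨p, G (K p)⟩` realizes `f` for every realizer `G` of `g`. -/
def WeihrauchLE (f g : Problem) : Prop :=
  ∃ K H : Baire →. Baire, ComputableFun K ∧ ComputableFun H ∧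
    ∀ G : Baire →. Baire, Realizes G g →
      Realizes (fun p => ((K p).bind G).bind fun q => H (seqPair p q)) f

/-- The jump of a problem: the representation of the source space is replaced by its jump. -/
noncomputable def Problem.jump (f : Problem) : Problem where
  X := f.X.jump
  Y := f.Y
  val := f.val

/-- The `n`-fold jump `f^(n)`. -/
noncomputable def Problem.iterJump (f : Problem) (n : ℕ) : Problem := Problem.jump^[n] f

/-! ### Measures -/

/-- The product measure on Baire space of the geometric measures `{n} ↦ 2^(-n-1)` on `ℕ`. -/
noncomputable def baireMeasure : Measure Baire :=
  Measure.infinitePi fun _ : ℕ =>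
    ProbabilityTheory.geometricMeasure ⟨1 / 2, by norm_num, by norm_num⟩

/-- The product measure on Cantor space of the uniform measures on `{0, 1}`. -/
noncomputable def cantorMeasure : Measure Cantor :=
  Measure.infinitePi fun _ : ℕ => (PMF.uniformOfFintype Bool).toMeasure

/-! ### Positive choice on Baire space -/

/-- Baire space, represented by the identity. -/
noncomputable def baireSpace : RepSpace :=
  RepSpace.ofInjective (id : Baire → Baire) Function.injective_id

/-- Enumeration of the open balls of Baire space: the empty set (ball of radius `0`) and the
cylinders `w ℕ^ℕ` of all finite words `w`. -/
def ball : ℕ → Set Baire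
  | 0 => ∅
  | n + 1 => {x | pre x (Denumerable.ofNat (List ℕ) n).length = Denumerable.ofNat (List ℕ) n}

theorem pre_eq_pre_iff {α : Type} {x y : ℕ → α} {n : ℕ} :
    pre x n = pre y n ↔ ∀ i < n, x i = y i := by
  simp [pre, List.map_inj_left]

theorem isOpen_ball (n : ℕ) : IsOpen (ball n) := by
  cases n with
  | zero => exact isOpen_empty
  | succ n =>
    rw [isOpen_iff_mem_nhds]
    intro x hx
    refine mem_of_superset ((PiNat.isOpen_cylinder (fun _ => ℕ) x
      (Denumerable.ofNat (List ℕ) n).length).mem_nhds (PiNat.self_mem_cylinder x _)) ?_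
    intro y hy
    exact (pre_eq_pre_iff.2 fun i hi => hy i hi).trans hx

theorem exists_ball_subset {U : Set Baire} (hU : IsOpen U) {x : Baire} (hx : x ∈ U) :
    ∃ n, x ∈ ball n ∧ ball n ⊆ U := by
  obtain ⟨_, ⟨z, m, rfl⟩, hxz, hzU⟩ :=
    (PiNat.isTopologicalBasis_cylinders (fun _ : ℕ => ℕ)).exists_subset_of_mem_open hx hU
  have hl : (pre x m).length = m := by simp [pre]
  refine ⟨Encodable.encode (pre x m) + 1, ?_, ?_⟩
  · simp [ball, hl]
  · intro y hy
    simp only [ball, Denumerable.ofNat_encode, hl, Set.mem_ofPred_eq] at hy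
    exact hzU fun i hi => (pre_eq_pre_iff.1 hy i hi).trans (hxz i hi)

/-- The space `𝒜₋(ℕ^ℕ)` of closed subsets of Baire space with respect to negative information:
`p` is a name of the complement of `⋃ i, ball (p i)`. -/
def closedBaire : RepSpace where
  carrier := TopologicalSpace.Closeds Baire
  rep := fun p => Part.some
    ⟨(⋃ i, ball (p i))ᶜ, (isOpen_iUnion fun i => isOpen_ball (p i)).isClosed_compl⟩
  surj := fun A => by
    classical
    refine ⟨fun i => if ball i ⊆ (A : Set Baire)ᶜ then i else 0, ?_⟩
    rw [Part.mem_some_iff]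
    apply TopologicalSpace.Closeds.ext
    change (A : Set Baire) =
      (⋃ i, ball (if ball i ⊆ (A : Set Baire)ᶜ then i else 0))ᶜ
    rw [eq_compl_comm]
    apply Set.Subset.antisymm
    · refine Set.iUnion_subset fun i => ?_
      split_ifs with h
      · exact h
      · exact Set.empty_subset _
    · intro x hx
      obtain ⟨n, hn, hnA⟩ := exists_ball_subset A.isClosed.isOpen_compl hx
      exact Set.mem_iUnion.2 ⟨n, by rwa [if_pos hnA]⟩

/-- Positive choice `PC_{ℕ^ℕ}`: given a closed set `A ⊆ ℕ^ℕ` of positive measure by negative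
information, find a point of `A`. -/
noncomputable def PCBaire : Problem where
  X := closedBaire
  Y := baireSpace
  val := fun A : TopologicalSpace.Closeds Baire =>
    {x : Baire | 0 < baireMeasure (A : Set Baire) ∧ x ∈ A}

/-! ### Weak König's Lemma and Weak Weak König's Lemma -/

/-- Cantor space; the name of a point is the point itself, as a sequence of `0`s and `1`s. -/
noncomputable def cantorSpace : RepSpace :=
  RepSpace.ofInjective (fun (x : Cantor) n => (x n).toNat) fun x y h => by
    funext n
    have hn : (x n).toNat = (y n).toNat := congrFun h n
    revert hn
    cases x n <;> cases y n <;> simp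

/-- Binary trees: sets of finite binary words that are closed under prefixes. -/
structure BinTree where
  /-- the words of the tree -/
  words : Set (List Bool)
  /-- closure under prefixes -/
  prefix_closed : ∀ u v : List Bool, u <+: v → v ∈ words → u ∈ words

open Classical in
/-- The characteristic function of a binary tree, for the standard numbering of binary words. -/
noncomputable def BinTree.charFun (T : BinTree) : Baire :=
  fun n => if ∃ w ∈ T.words, Encodable.encode w = n then 1 else 0

theorem BinTree.charFun_injective : Function.Injective BinTree.charFun := by
  rintro ⟨S, hS⟩ ⟨T, hT⟩ h
  have : S = T := by
    ext w
    have := congrFun h (Encodable.encode w)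
    simp only [BinTree.charFun, Encodable.encode_inj, exists_eq_right] at this
    by_cases h1 : w ∈ S <;> by_cases h2 : w ∈ T <;> simp_all
  subst this
  rfl

/-- The space `Tr` of binary trees, represented by their characteristic functions. -/
noncomputable def treeSpace : RepSpace :=
  RepSpace.ofInjective BinTree.charFun BinTree.charFun_injective

/-- The set `[T]` of infinite paths of a binary tree. -/
def BinTree.paths (T : BinTree) : Set Cantor := {x | ∀ n, pre x n ∈ T.words}

/-- Weak König's Lemma: given an infinite binary tree, find an infinite path. -/
noncomputable def WKL : Problem where
  X := treeSpace
  Y := cantorSpace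
  val := fun T : BinTree => {x : Cantor | T.words.Infinite ∧ x ∈ T.paths}

/-- Weak Weak König's Lemma: given a binary tree whose set of infinite paths has positive
measure, find an infinite path. -/
noncomputable def WWKL : Problem where
  X := treeSpace
  Y := cantorSpace
  val := fun T : BinTree => {x : Cantor | 0 < cantorMeasure T.paths ∧ x ∈ T.paths}

end Weih

namespace Weih

open MeasureTheory Filter Topology

/-! ### Prefixes -/

/-! A reduction turns an instance `T` of `WKL` into one instance of `g`, and the outer function must
send all solutions of that instance to paths of `T`. If the solution names contain a set `A` of
positive measure, this fails for a suitable `T`. A countable family of pairs (`D k`, `ε k`)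
approximates every such `A`, and position `k` of `T` is reserved for the `k`-th pair: once more than
`ε k` of `D k` votes for the same `k`-th output bit, `T` forbids that bit. The votes depend on `T`
as oracle, but a word is affected only by shorter oracle prefixes, so `T` exists by recursion
(`exists_avoiding_tree`). If `A` were mapped into the paths, some bit would be elected, and one of
its voters would lie in `A`, a contradiction (`not_forall_path_of_avoiding`). Only monotonicity of
the outer word function matters, not computability. Jumps change nothing, since they leave solutions
and their names alone. -/

theorem length_pre {α : Type} (x : ℕ → α) (n : ℕ) : (pre x n).length = n := by simp [pre]

theorem getElem?_pre {α : Type} (x : ℕ → α) {n k : ℕ} (h : k < n) : (pre x n)[k]? = some (x k) := by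
  simp [pre, h]

theorem pre_prefix_pre {α : Type} (x : ℕ → α) {m n : ℕ} (h : m ≤ n) : pre x m <+: pre x n := by
  obtain ⟨d, rfl⟩ := Nat.exists_eq_add_of_le h
  rw [pre, pre, List.range_add, List.map_append]
  exact List.prefix_append _ _

theorem getElem?_of_prefix {α : Type} {u v : List α} (h : u <+: v) {k : ℕ} {a : α}
    (hk : u[k]? = some a) : v[k]? = some a := by
  obtain ⟨hl, rfl⟩ := List.getElem?_eq_some_iff.1 hk
  rw [h.getElem hl]
  exact List.getElem?_eq_getElem _

/-- This makes the tree recursion causal: membership of a word may use the oracle below its length,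
hence below its code. -/
theorem length_le_encode (u : List Bool) : u.length ≤ Encodable.encode u := by
  induction u with
  | nil => simp
  | cons a l ih =>
    rw [Encodable.encode_list_cons, List.length_cons]
    exact Nat.succ_le_succ (ih.trans (Nat.right_le_pair _ _))

theorem pre_seqPair_congr {p q : Baire} (x : Baire) {n : ℕ} (h : ∀ i < n, p i = q i) :
    pre (seqPair p x) n = pre (seqPair q x) n := by
  rw [pre_eq_pre_iff]
  intro i hi
  simp only [seqPair]
  rw [h (i / 2) (lt_of_le_of_lt (Nat.div_le_self _ _) hi)]

/-- A causal operator on Baire space, whose output at `n` depends on the input below `n` only,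
has a fixed point. -/
theorem exists_fixedPoint_of_causal (Φ : Baire → Baire)
    (h : ∀ (p q : Baire) (n : ℕ), (∀ m < n, p m = q m) → Φ p n = Φ q n) : ∃ p, Φ p = p := by
  let F : (n : ℕ) → ((m : ℕ) → m < n → ℕ) → ℕ :=
    -- The padding value 0 is arbitrary, because output `n` ignores entries from `n` on.
    fun n r => Φ (fun m => if hm : m < n then r m hm else 0) n
  refine ⟨fun n => Nat.strongRec F n, funext fun n => ?_⟩
  rw [Nat.strongRec_eq]
  refine h _ _ n fun m hm => ?_
  rw [dif_pos hm]

/-! ### Countable approximation of sets of positive measure -/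

/-- Countably many sets with error bounds approximate every set of positive measure up to
a third of its measure. -/
theorem exists_seq_approx {X : Type*} [MeasurableSpace X] (ν : Measure X) [IsFiniteMeasure ν]
    [IsSeparable ν] :
    ∃ (D : ℕ → Set X) (ε : ℕ → ENNReal), ∀ A, MeasurableSet A → 0 < ν A →
      ∃ k, ν (A \ D k) < ε k ∧ ν (D k \ A) < ε k ∧ 3 * ε k ≤ ν A := by
  obtain ⟨𝒜, hc, hd⟩ := IsSeparable.exists_countable_measureDense (μ := ν)
  obtain ⟨S, rfl⟩ := hc.exists_eq_range hd.nonempty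
  -- The index `k` codes a set of the dense family together with a tolerance 1/n.
  refine ⟨fun k => S k.unpair.1, fun k => ((k.unpair.2 : ℕ) : ENNReal)⁻¹, fun A hA hpos => ?_⟩
  obtain ⟨n, hn⟩ := ENNReal.exists_inv_nat_lt (a := ν A / 3)
    (ENNReal.div_pos hpos.ne' (by simp)).ne'
  have hfin : ((n : ℕ) : ENNReal)⁻¹ ≠ ⊤ := ne_top_of_lt hn
  obtain ⟨_, ⟨i, rfl⟩, hi⟩ := hd.approx A hA (measure_ne_top _ _) ((n : ENNReal)⁻¹).toReal
    (ENNReal.toReal_pos (by simp) hfin)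
  rw [ENNReal.ofReal_toReal hfin] at hi
  refine ⟨Nat.pair i n, ?_, ?_, ?_⟩
  · simp only [Nat.unpair_pair]
    exact (measure_mono fun x hx => Or.inl hx).trans_lt hi
  · simp only [Nat.unpair_pair]
    exact (measure_mono fun x hx => Or.inr hx).trans_lt hi
  · simp only [Nat.unpair_pair]
    rw [mul_comm]
    exact (ENNReal.le_div_iff_mul_le (by simp) (by simp)).1 hn.le

/-! ### A tree that defeats majority votes -/

section Diagonalization

variable (ν : Measure Baire) (D : ℕ → Set Baire) (ε : ℕ → ENNReal) (φ : List ℕ → List ℕ)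

/-- The points of `D k` for which `φ`, with oracle `p`, has put out `b` as `k`-th bit by stage
`j`. -/
def voters (p : Baire) (j k : ℕ) (b : Bool) : Set Baire :=
  {x | x ∈ D k ∧ (φ (pre (seqPair p x) j))[k]? = some b.toNat}

/-- By stage `j` the voters for `b` as `k`-th bit have measure more than `ε k`. -/
def Elected (p : Baire) (j k : ℕ) (b : Bool) : Prop := ε k < ν (voters D φ p j k b)

/-- `j` is the first stage at which some bit is elected at position `k`, and `b` is the least bit
elected then. -/
def FirstElected (p : Baire) (j k : ℕ) (b : Bool) : Prop :=
  Elected ν D ε φ p j k b ∧ (∀ i < j, ∀ c, ¬ Elected ν D ε φ p i k c) ∧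
    (b = true → ¬ Elected ν D ε φ p j k false)

/-- The word `u` avoids all bits that are elected by stage `u.length`. -/
def Avoids (p : Baire) (u : List Bool) : Prop :=
  ∀ k b, u[k]? = some b → ∀ j ≤ u.length, ¬ FirstElected ν D ε φ p j k b

theorem elected_congr {p q : Baire} {j : ℕ} (h : ∀ i < j, p i = q i) (k : ℕ) (b : Bool) :
    Elected ν D ε φ p j k b ↔ Elected ν D ε φ q j k b := by
  simp only [Elected, voters, pre_seqPair_congr _ h]

theorem firstElected_congr {p q : Baire} {j : ℕ} (h : ∀ i < j, p i = q i) (k : ℕ) (b : Bool) :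
    FirstElected ν D ε φ p j k b ↔ FirstElected ν D ε φ q j k b := by
  have hi : ∀ i < j, ∀ c, Elected ν D ε φ p i k c ↔ Elected ν D ε φ q i k c := fun i hi c =>
    elected_congr ν D ε φ (fun m hm => h m (hm.trans hi)) k c
  simp only [FirstElected, elected_congr ν D ε φ h]
  refine and_congr_right fun _ => and_congr_left fun _ => ?_
  exact forall₃_congr fun i hij c => not_congr (hi i hij c)

theorem avoids_congr {p q : Baire} {u : List Bool} (h : ∀ i < u.length, p i = q i) :
    Avoids ν D ε φ p u ↔ Avoids ν D ε φ q u :=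
  forall₅_congr fun k b _ _ hj =>
    not_congr (firstElected_congr ν D ε φ (fun i hi => h i (hi.trans_le hj)) k b)

theorem Avoids.of_prefix {p : Baire} {u v : List Bool} (h : u <+: v)
    (hv : Avoids ν D ε φ p v) : Avoids ν D ε φ p u :=
  fun k b hk j hj => hv k b (getElem?_of_prefix h hk) j (hj.trans h.length_le)

variable {ν D ε φ}

/-- Hence at most one bit per position is ever forbidden, which keeps the tree infinite. -/
theorem FirstElected.unique {p : Baire} {j j' k : ℕ}
    (h : FirstElected ν D ε φ p j k false) : ¬ FirstElected ν D ε φ p j' k true := by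
  intro h'
  rcases lt_trichotomy j j' with hl | rfl | hl
  · exact h'.2.1 j hl _ h.1
  · exact h'.2.2 rfl h.1
  · exact h.2.1 j' hl _ h'.1

theorem exists_firstElected {p : Baire} {k : ℕ} (h : ∃ j b, Elected ν D ε φ p j k b) :
    ∃ j b, FirstElected ν D ε φ p j k b := by
  classical
  obtain ⟨b, hb⟩ := Nat.find_spec h
  have hmin : ∀ i < Nat.find h, ∀ c, ¬ Elected ν D ε φ p i k c := fun i hi c hc =>
    Nat.find_min h hi ⟨c, hc⟩
  by_cases hf : Elected ν D ε φ p (Nat.find h) k false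
  · exact ⟨_, false, hf, hmin, by simp⟩
  · exact ⟨_, b, hb, hmin, fun _ => hf⟩

variable (ν D ε φ)

/-- There is a tree that consists of the words avoiding all bits elected with the tree itself as
oracle. -/
theorem exists_avoiding_tree :
    ∃ T : BinTree, ∀ u, u ∈ T.words ↔ Avoids ν D ε φ T.charFun u := by
  classical
  obtain ⟨p, hp⟩ := exists_fixedPoint_of_causal
    (fun p n => if ∃ w, Avoids ν D ε φ p w ∧ Encodable.encode w = n then 1 else 0) (by
      intro p q n h
      congr 1
      refine propext (exists_congr fun w => and_congr_left fun hw => ?_)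
      exact avoids_congr ν D ε φ fun i hi => h i (hi.trans_le ((length_le_encode w).trans hw.le)))
  let T : BinTree := ⟨{u | Avoids ν D ε φ p u}, fun u v h hv => Avoids.of_prefix ν D ε φ h hv⟩
  have hT : T.charFun = p := by
    rw [← hp]
    funext n
    simp only [BinTree.charFun, T, Set.mem_ofPred_eq]
  exact ⟨T, fun u => by rw [hT]; rfl⟩

variable {ν D ε φ}

theorem exists_path_of_avoiding {T : BinTree}
    (hT : ∀ u, u ∈ T.words ↔ Avoids ν D ε φ T.charFun u) : ∃ y, y ∈ T.paths := by
  classical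
  -- Take 1 exactly where 0 gets forbidden.
  refine ⟨fun k => decide (∃ j, FirstElected ν D ε φ T.charFun j k false), fun n => ?_⟩
  rw [hT]
  intro k b hk j _ hf
  have hkn : k < n := by
    have := (List.getElem?_eq_some_iff.1 hk).1
    rwa [length_pre] at this
  rw [getElem?_pre _ hkn, Option.some_inj] at hk
  cases b with
  | false => exact of_decide_eq_false hk ⟨j, hf⟩
  | true =>
    obtain ⟨i, hi⟩ := of_decide_eq_true hk
    exact hi.unique hf

/-- `φ` does not map all oracles from a well-approximated set to paths of the avoiding tree. -/
theorem not_forall_path_of_avoiding [IsFiniteMeasure ν]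
    (hφ : ∀ u v : List ℕ, u <+: v → φ u <+: φ v) {T : BinTree}
    (hT : ∀ u, u ∈ T.words ↔ Avoids ν D ε φ T.charFun u) {A : Set Baire} {k : ℕ}
    (h₁ : ν (A \ D k) < ε k) (h₂ : ν (D k \ A) < ε k) (h₃ : 3 * ε k ≤ ν A) :
    ¬ ∀ x ∈ A, ∃ y ∈ T.paths, ∀ m, ∃ n,
      pre (fun i => (y i).toNat) m <+: φ (pre (seqPair T.charFun x) n) := by
  intro H
  have hmono : ∀ b, Monotone fun j => voters D φ T.charFun j k b := fun b i j hij x hx =>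
    ⟨hx.1, getElem?_of_prefix (hφ _ _ (pre_prefix_pre _ hij)) hx.2⟩
  -- Otherwise each bit gets at most `ε k` of the votes in total, and `A` is covered by these voters
  -- and `A \ D k`, so its measure is below `3 * ε k`.
  have hex : ∃ j b, Elected ν D ε φ T.charFun j k b := by
    by_contra hno
    push Not at hno
    have hb : ∀ b, ν (⋃ j, voters D φ T.charFun j k b) ≤ ε k := fun b => by
      rw [(hmono b).measure_iUnion]
      exact iSup_le fun j => not_lt.1 (hno j b)
    have hcov : A ⊆ (A \ D k) ∪ ((⋃ j, voters D φ T.charFun j k false) ∪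
        ⋃ j, voters D φ T.charFun j k true) := by
      intro x hx
      by_cases hD : x ∈ D k
      · obtain ⟨y, -, hy⟩ := H x hx
        obtain ⟨n, hn⟩ := hy (k + 1)
        have hv := getElem?_of_prefix hn (getElem?_pre _ (Nat.lt_succ_self k))
        right
        cases hyk : y k with
        | false => exact Or.inl (Set.mem_iUnion.2 ⟨n, hD, by rw [hv, hyk]⟩)
        | true => exact Or.inr (Set.mem_iUnion.2 ⟨n, hD, by rw [hv, hyk]⟩)
      · exact Or.inl ⟨hx, hD⟩
    have hε : ε k ≠ ⊤ := by
      intro htop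
      rw [htop, ENNReal.mul_top (by simp)] at h₃
      exact measure_ne_top ν A (top_le_iff.1 h₃)
    have hlt : ν A < ε k + (ε k + ε k) := by
      refine (measure_mono hcov).trans_lt ((measure_union_le _ _).trans_lt ?_)
      refine ENNReal.add_lt_add_of_lt_of_le ?_ h₁ ?_
      · exact ne_top_of_le_ne_top (ENNReal.add_ne_top.2 ⟨hε, hε⟩)
          ((measure_union_le _ _).trans (add_le_add (hb _) (hb _)))
      · exact (measure_union_le _ _).trans (add_le_add (hb _) (hb _))
    refine hlt.not_ge (le_of_eq_of_le ?_ h₃)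
    ring
  obtain ⟨j, b, hj⟩ := exists_firstElected hex
  -- The winning voters outweigh `D k \ A`.
  have hne : (voters D φ T.charFun j k b ∩ A).Nonempty := by
    by_contra hempty
    rw [Set.not_nonempty_iff_eq_empty] at hempty
    have hsub : voters D φ T.charFun j k b ⊆ D k \ A := fun x hx =>
      ⟨hx.1, fun hxA => (hempty.le ⟨hx, hxA⟩ : x ∈ (∅ : Set Baire))⟩
    exact (hj.1.trans_le (measure_mono hsub)).not_gt h₂
  obtain ⟨x, hxv, hxA⟩ := hne
  obtain ⟨y, hyT, hy⟩ := H x hxA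
  obtain ⟨n, hn⟩ := hy (k + 1)
  have hk := getElem?_of_prefix (hn.trans (hφ _ _ (pre_prefix_pre _ (le_max_left n j))))
    (getElem?_pre _ (Nat.lt_succ_self k))
  have hk' := getElem?_of_prefix (hφ _ _ (pre_prefix_pre _ (le_max_right n j))) hxv.2
  have hyk : y k = b := by
    have : (y k).toNat = b.toNat := Option.some_inj.1 (hk.symm.trans hk')
    revert this
    cases y k <;> cases b <;> simp
  -- The prefix must be long enough both to contain bit `k` and to notice an election at stage `j`.
  refine (hT _).1 (hyT (max j (k + 1))) k b ?_ j ?_ hj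
  · rw [getElem?_pre _ (lt_of_lt_of_le (Nat.lt_succ_self k) (le_max_right _ _)), hyk]
  · rw [length_pre]
    exact le_max_left _ _

end Diagonalization

/-- For every monotone word function and every finite measure there is an infinite binary tree such
that no set of oracles of positive measure is mapped to paths of the tree. -/
theorem exists_tree_not_forall_path (ν : Measure Baire) [IsFiniteMeasure ν] {φ : List ℕ → List ℕ}
    (hφ : ∀ u v : List ℕ, u <+: v → φ u <+: φ v) :
    ∃ T : BinTree, (∃ y, y ∈ T.paths) ∧ ∀ A, MeasurableSet A → 0 < ν A →
      ¬ ∀ x ∈ A, ∃ y ∈ T.paths, ∀ m, ∃ n,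
        pre (fun i => (y i).toNat) m <+: φ (pre (seqPair T.charFun x) n) := by
  obtain ⟨D, ε, hD⟩ := exists_seq_approx ν
  obtain ⟨T, hT⟩ := exists_avoiding_tree ν D ε φ
  refine ⟨T, exists_path_of_avoiding hT, fun A hA hpos => ?_⟩
  obtain ⟨k, h₁, h₂, h₃⟩ := hD A hA hpos
  exact not_forall_path_of_avoiding hφ hT h₁ h₂ h₃

theorem BinTree.infinite_words {T : BinTree} {y : Cantor} (hy : y ∈ T.paths) :
    T.words.Infinite := by
  refine Set.infinite_of_injective_forall_mem (f := fun n => pre y n) (fun m n h => ?_) hy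
  simpa only [length_pre] using congrArg List.length h

theorem BinTree.isClosed_paths (T : BinTree) : IsClosed T.paths := by
  have : T.paths = ⋂ n, {x | pre x n ∈ T.words} := by ext; simp [BinTree.paths]
  rw [this]
  refine isClosed_iInter fun n => ?_
  have hc : Continuous fun (x : Cantor) (i : Fin n) => x i := by fun_prop
  have : {x : Cantor | pre x n ∈ T.words} =
      (fun (x : Cantor) (i : Fin n) => x i) ⁻¹' {z | List.ofFn z ∈ T.words} := by
    ext x
    have hx : pre x n = List.ofFn fun i : Fin n => x i :=
      List.ext_getElem (by simp [pre]) (by simp [pre])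
    simp only [Set.mem_ofPred_eq, Set.mem_preimage, hx]
  rw [this]
  exact (isClosed_discrete _).preimage hc

/-! ### Problems with many solutions -/

theorem RepSpace.mem_ofInjective_rep {X : Type} {c : X → Baire} (hc : Function.Injective c)
    {p : Baire} {x : X} : x ∈ (RepSpace.ofInjective c hc).rep p ↔ c x = p := by
  constructor
  · rintro ⟨h, rfl⟩
    exact h.choose_spec
  · rintro rfl
    exact ⟨⟨x, rfl⟩, hc (Exists.choose_spec (⟨x, rfl⟩ : ∃ y, c y = c x))⟩

theorem mem_cantorSpace_rep {p : Baire} {y : Cantor} :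
    y ∈ cantorSpace.rep p ↔ (fun n => (y n).toNat) = p := by
  unfold cantorSpace
  exact RepSpace.mem_ofInjective_rep _

/-- Every instance of `g` has a set of solutions whose names form a set of positive measure. -/
def HasManySolutions (ν : Measure Baire) (g : Problem) : Prop :=
  ∀ x ∈ g.dom, ∃ A, MeasurableSet A ∧ 0 < ν A ∧ ∀ q ∈ A, ∃ y ∈ g.Y.rep q, y ∈ g.val x

/-- A jump changes only the names of instances, which the property does not mention. -/
theorem HasManySolutions.iterJump {ν : Measure Baire} {g : Problem} (h : HasManySolutions ν g)
    (n : ℕ) : HasManySolutions ν (g.iterJump n) := by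
  induction n generalizing g with
  | zero => exact h
  | succ n ih => exact ih (g := g.jump) h

/-- If `f` reduces to `g`, then to every instance of `f` belongs an instance of `g` all of whose
solutions are mapped to solutions by the outer reduction function. -/
theorem exists_instance_of_reduction {f g : Problem} {K H : Baire →. Baire}
    (h : ∀ G : Baire →. Baire, Realizes G g →
      Realizes (fun p => ((K p).bind G).bind fun q => H (seqPair p q)) f)
    {p : Baire} {x : f.X.carrier} (hp : x ∈ f.X.rep p) (hx : x ∈ f.dom) :
    ∃ z ∈ g.dom, ∀ q, (∃ y ∈ g.Y.rep q, y ∈ g.val z) →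
      ∃ r ∈ H (seqPair p q), ∃ y ∈ f.Y.rep r, y ∈ f.val x := by
  classical
  have hreal : ∀ s, (∃ z ∈ g.X.rep s, z ∈ g.dom) →
      ∃ q, ∀ z ∈ g.X.rep s, ∃ y ∈ g.Y.rep q, y ∈ g.val z := by
    rintro s ⟨z, hz, y, hy⟩
    obtain ⟨q, hq⟩ := g.Y.surj y
    exact ⟨q, fun z' hz' => ⟨y, hq, Part.mem_unique hz hz' ▸ hy⟩⟩
  choose! R hR using hreal
  -- Being undefined elsewhere, `G` forces `s = K p` to name a point of the domain of `g`.
  let G : Baire →. Baire := fun s => ⟨∃ z ∈ g.X.rep s, z ∈ g.dom, fun _ => R s⟩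
  have hG : Realizes G g := fun s z hz hzd =>
    ⟨R s, ⟨⟨z, hz, hzd⟩, rfl⟩, hR s ⟨z, hz, hzd⟩ z hz⟩
  obtain ⟨r, hr, -⟩ := h G hG p x hp hx
  obtain ⟨q, hq, -⟩ := Part.mem_bind_iff.1 hr
  obtain ⟨s, hs, ⟨z, hz, hzd⟩, -⟩ := Part.mem_bind_iff.1 hq
  refine ⟨z, hzd, fun q' hq' => ?_⟩
  -- Any solution `q'` may be prescribed at the single name `s`; the result is again a realizer.
  let G' : Baire →. Baire := fun t => if t = s then Part.some q' else G t
  have hG' : Realizes G' g := by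
    intro t z' hz' hzd'
    by_cases ht : t = s
    · subst ht
      refine ⟨q', by simp [G'], ?_⟩
      rwa [Part.mem_unique hz' hz]
    · simp only [G', if_neg ht]
      exact hG t z' hz' hzd'
  obtain ⟨r', hr', hy'⟩ := h G' hG' p x hp hx
  obtain ⟨q'', hq'', hH⟩ := Part.mem_bind_iff.1 hr'
  obtain ⟨s', hs', hGs⟩ := Part.mem_bind_iff.1 hq''
  obtain rfl := Part.mem_unique hs hs'
  simp only [G', if_true, Part.mem_some_iff] at hGs
  subst hGs
  exact ⟨r', hH, hy'⟩

/-- Weak König's Lemma does not reduce to a problem with many solutions. -/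
theorem HasManySolutions.not_WKL_le {ν : Measure Baire} [IsFiniteMeasure ν] {g : Problem}
    (hg : HasManySolutions ν g) : ¬ WeihrauchLE WKL g := by
  rintro ⟨K, H, -, ⟨φ, -, hφ, hH⟩, hKH⟩
  obtain ⟨T, ⟨y, hy⟩, hT⟩ := exists_tree_not_forall_path ν hφ
  have hname : T ∈ treeSpace.rep T.charFun :=
    (RepSpace.mem_ofInjective_rep BinTree.charFun_injective).2 rfl
  have hdom : T ∈ WKL.dom := ⟨y, BinTree.infinite_words hy, hy⟩
  obtain ⟨z, hz, hsol⟩ := exists_instance_of_reduction (f := WKL) hKH hname hdom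
  obtain ⟨A, hA, hpos, hAz⟩ := hg z hz
  refine hT A hA hpos fun x hx => ?_
  obtain ⟨r, hr, y', hy', -, hpath⟩ := hsol x (hAz x hx)
  have hr' := mem_cantorSpace_rep.1 hy'
  refine ⟨y', hpath, ?_⟩
  rw [hr']
  exact hH _ r hr

/-! ### Positive choice and Weak Weak König's Lemma have many solutions -/

theorem hasManySolutions_PCBaire : HasManySolutions baireMeasure PCBaire := by
  rintro (A : TopologicalSpace.Closeds Baire) ⟨x, hpos, -⟩
  exact ⟨A, A.isClosed.measurableSet, hpos, fun q hq =>
    ⟨q, (RepSpace.mem_ofInjective_rep Function.injective_id).2 rfl, hpos, hq⟩⟩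

theorem continuous_toNat_comp : Continuous fun (x : Cantor) n => (x n).toNat :=
  continuous_pi fun n =>
    (continuous_of_discreteTopology (f := Bool.toNat)).comp (continuous_apply n)

theorem hasManySolutions_WWKL :
    HasManySolutions (cantorMeasure.map fun (x : Cantor) n => (x n).toNat) WWKL := by
  rintro (T : BinTree) ⟨x, hpos, -⟩
  -- Compactness of the path set makes its image in Baire space closed.
  have hA : MeasurableSet ((fun (x : Cantor) n => (x n).toNat) '' T.paths) :=
    (T.isClosed_paths.isCompact.image continuous_toNat_comp).isClosed.measurableSet
  refine ⟨_, hA, ?_, ?_⟩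
  · rw [Measure.map_apply continuous_toNat_comp.measurable hA]
    exact lt_of_lt_of_le hpos (measure_mono (Set.subset_preimage_image _ _))
  · rintro _ ⟨y, hy, rfl⟩
    exact ⟨y, mem_cantorSpace_rep.2 rfl, hpos, hy⟩

instance isProbabilityMeasure_baireMeasure : IsProbabilityMeasure baireMeasure := by
  unfold baireMeasure; infer_instance

instance isProbabilityMeasure_cantorMeasure : IsProbabilityMeasure cantorMeasure := by
  unfold cantorMeasure; infer_instance

end Weih

theorem corollary14p8 :
    (∀ n : ℕ, ¬ Weih.WeihrauchLE Weih.WKL (Weih.PCBaire.iterJump n)) ∧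
      (∀ n : ℕ, ¬ Weih.WeihrauchLE Weih.WKL (Weih.WWKL.iterJump n)) :=
  ⟨fun n => (Weih.hasManySolutions_PCBaire.iterJump n).not_WKL_le,
    fun n => (Weih.hasManySolutions_WWKL.iterJump n).not_WKL_le⟩
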